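/- Let $\mathbb{K}$ be an algebraically closed field of characteristic $0$, let $m\in\mathbb{N}$, and let $f\in\mathbb{K}\langle x_1,\dots,x_m\rangle$ be a nonconstant noncommutative polynomial, i.e. an element of the free $\mathbb{K}$-algebra on $x_1,\dots,x_m$ that does not lie in $\mathbb{K}$. Let $\deg f$ be the largest length of a word that occurs in $f$ with nonzero coefficient. For $n\in\mathbb{N}$ put $$\mathcal{O}_f(n)=\{X\in M_n(\mathbb{K})^m : f(X)\text{ has } n \text{ distinct eigenvalues, all of them nonzero}\}.$$ Then for all sufficiently large $n$, the set $\mathcal{O}_f(n)$ is nonempty and Zariski open in the affine space $M_n(\mathbb{K})^m$. More precisely, if $p<q$ are any primes with $p>\lceil \tfrac{\deg f}{2}\rceil$, then $\mathcal{O}_f(n)$ is nonempty and Zariski open in $M_n(\mathbb{K})^m$ for every $n\ge (p-1)(q-1)$. -/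

import Mathlib

noncomputable section

namespace NCPoly

/-- The degree of a noncommutative polynomial: the largest length of a word (monomial) that
occurs in it with nonzero coefficient. The zero polynomial gets degree `0`. -/
def deg {K : Type*} [Field K] {m : ℕ} (f : FreeAlgebra K (Fin m)) : ℕ :=
  (FreeAlgebra.equivMonoidAlgebraFreeMonoid f).coeff.support.sup FreeMonoid.length

/-- A noncommutative polynomial is nonconstant if it is not in the copy of `K` in `K⟨x⟩`. -/
def Nonconstant {K : Type*} [Field K] {m : ℕ} (f : FreeAlgebra K (Fin m)) : Prop :=
  f ∉ Set.range (algebraMap K (FreeAlgebra K (Fin m)))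

/-- The value `f(X)` at a tuple `X` of `m` matrices of size `n × n`. -/
def eval {K : Type*} [Field K] {m n : ℕ} (f : FreeAlgebra K (Fin m))
    (X : Fin m → Matrix (Fin n) (Fin n) K) : Matrix (Fin n) (Fin n) K :=
  FreeAlgebra.lift K X f

/-- The set of eigenvalues in `K` of an `n × n` matrix. -/
def eigenvalueSet {K : Type*} [Field K] {n : ℕ} (A : Matrix (Fin n) (Fin n) K) : Set K :=
  {μ | Module.End.HasEigenvalue (Matrix.toLin' A) μ}

/-- The set of tuples `X` for which `f(X)` has `n` distinct eigenvalues, all of them nonzero. -/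
def distinctNonzeroLocus {K : Type*} [Field K] {m : ℕ} (f : FreeAlgebra K (Fin m)) (n : ℕ) :
    Set (Fin m → Matrix (Fin n) (Fin n) K) :=
  {X | (eigenvalueSet (eval f X)).ncard = n ∧ ∀ μ ∈ eigenvalueSet (eval f X), μ ≠ 0}

/-- Zariski open subsets of the affine space of `m`-tuples of `n × n` matrices, the coordinates
being the `m * n * n` matrix entries: complements of common zero sets of polynomials. -/
def IsZariskiOpen {K : Type*} [Field K] {m n : ℕ}
    (U : Set (Fin m → Matrix (Fin n) (Fin n) K)) : Prop :=
  ∃ I : Ideal (MvPolynomial (Fin m × Fin n × Fin n) K),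
    U = {X | (fun k => X k.1 k.2.1 k.2.2) ∉ MvPolynomial.zeroLocus K I}

end NCPoly

end

/-! Openness: on generic matrices, the discriminant of the characteristic polynomial of `f` times
the determinant of `f` is a polynomial in the entries, and the locus is where it does not vanish.

Nonemptiness in prime size `p`: the clock and shift matrices `U`, `V` commute up to a primitive
`p`-th root of unity, and the monomials `U ^ i * V ^ j` span the matrix algebra. Each monomial is
scalar or has `p` distinct eigenvalues. Given `X` with `f(X)` nonscalar, expand `X` in monomials and
replace `U`, `V` by `x • U`, `y • V`. The value of `f` becomes a polynomial in `x`, `y` whose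
coefficients are multiples of monomials. For suitable `x`, `y` its lowest nonscalar term forces
distinct eigenvalues (`OpenCondition.exists_of_monomials`).

A nonscalar value exists when `deg f ≤ 2 * p - 2`: polarizing `f` along a staircase of matrix units
isolates one word of top degree and yields an off-diagonal matrix unit (`exists_eval_nonscalar`).

General size: every `n ≥ (p - 1) * (q - 1)` is `a * p + b * q`. Block sums of values with disjoint
spectra finish the proof, and therefore the statement in prime size also avoids any prescribed
finite set of eigenvalues. -/

open Polynomial in
/-- The resultant of the characteristic polynomial of a matrix and its derivative. -/
noncomputable def charpolyDisc {R n : Type*} [CommRing R] [Fintype n] [DecidableEq n]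
    (A : Matrix n n R) : R :=
  resultant A.charpoly (derivative A.charpoly) (Fintype.card n) (Fintype.card n - 1)

/-! ### Discriminants and distinct eigenvalues. -/

section charpolyDisc

variable {n : Type*} [Fintype n] [DecidableEq n]

/-- The resultant is taken with degrees fixed by the matrix size, so it commutes with every ring
homomorphism even if the derivative drops degree. -/
theorem charpolyDisc_map {R S : Type*} [CommRing R] [CommRing S] (φ : R →+* S)
    (A : Matrix n n R) : charpolyDisc (A.map φ) = φ (charpolyDisc A) := by
  rw [charpolyDisc, charpolyDisc, Matrix.charpoly_map, Polynomial.derivative_map,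
    Polynomial.resultant_map_map]

theorem charpolyDisc_ne_zero_iff {K : Type*} [Field K] [CharZero K] (A : Matrix n n K) :
    charpolyDisc A ≠ 0 ↔ A.charpoly.Separable := by
  have h1 : A.charpoly.natDegree = Fintype.card n := A.charpoly_natDegree_eq_dim
  have h2 : (Polynomial.derivative A.charpoly).natDegree = Fintype.card n - 1 := by
    rw [Polynomial.natDegree_derivative, h1]
  have h3 : charpolyDisc A = Polynomial.resultant A.charpoly (Polynomial.derivative A.charpoly) := by
    rw [charpolyDisc, h1, h2]
  rw [h3, Ne, Polynomial.resultant_eq_zero_iff, Polynomial.Separable]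
  simp [A.charpoly_monic.ne_zero]

theorem charpoly_separable_iff_card_roots {K : Type*} [Field K] [IsAlgClosed K] [DecidableEq K]
    (A : Matrix n n K) :
    A.charpoly.Separable ↔ Fintype.card n ≤ A.charpoly.roots.toFinset.card := by
  have hs : A.charpoly.Splits := IsAlgClosed.splits _
  have hc : Multiset.card A.charpoly.roots = Fintype.card n := by
    rw [← hs.natDegree_eq_card_roots, A.charpoly_natDegree_eq_dim]
  rw [← Polynomial.nodup_roots_iff_of_splits A.charpoly_monic.ne_zero hs, ← hc]
  constructor
  · intro h
    rw [Multiset.toFinset_card_of_nodup h]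
  · intro h
    exact Multiset.toFinset_card_eq_card_iff_nodup.mp
      (le_antisymm (Multiset.toFinset_card_le _) h)

theorem exists_ne_zero_eval_ne_zero {K : Type*} [Field K] [Infinite K]
    (P : Polynomial K) (h : P.eval 0 ≠ 0) : ∃ t : K, t ≠ 0 ∧ P.eval t ≠ 0 := by
  by_contra! H
  have : Polynomial.X * P = 0 := by
    refine Polynomial.funext fun t => ?_
    rcases eq_or_ne t 0 with rfl | ht
    · simp
    · simp [H t ht]
  rcases mul_eq_zero.mp this with h' | h'
  · exact Polynomial.X_ne_zero h'
  · simp [h'] at h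

theorem isRoot_charpoly_iff_det_eq_zero {K : Type*} [Field K] (A : Matrix n n K) (z : K) :
    A.charpoly.IsRoot z ↔ (A - algebraMap K _ z).det = 0 := by
  rw [Polynomial.IsRoot, Matrix.eval_charpoly, ← neg_sub, Matrix.det_neg]
  simp [Matrix.algebraMap_eq_diagonal, Matrix.scalar_apply, Pi.algebraMap_def]

end charpolyDisc

/-! ### Generic matrices and Zariski openness. -/

section generic

variable {n σ : Type*} [Fintype n] [DecidableEq n]

/-- The tuple of generic `n × n` matrices indexed by `σ`. -/
noncomputable def genericMatrix (K n σ : Type*) [Field K] (k : σ) :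
    Matrix n n (MvPolynomial (σ × n × n) K) :=
  Matrix.of fun i j => MvPolynomial.X (k, i, j)

theorem map_lift_genericMatrix {K : Type*} [Field K] (f : FreeAlgebra K σ)
    (X : σ → Matrix n n K) :
    (FreeAlgebra.lift K (genericMatrix K n σ) f).map
      (MvPolynomial.eval fun k : σ × n × n => X k.1 k.2.1 k.2.2) = FreeAlgebra.lift K X f := by
  have : ((MvPolynomial.aeval fun k : σ × n × n => X k.1 k.2.1 k.2.2).mapMatrix.comp
      (FreeAlgebra.lift K (genericMatrix K n σ))) = FreeAlgebra.lift K X := by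
    ext k i j
    simp [genericMatrix]
  simpa [MvPolynomial.coe_aeval_eq_eval] using congr($this f)

theorem eval_charpolyDisc_generic {K : Type*} [Field K] (f : FreeAlgebra K σ)
    (X : σ → Matrix n n K) :
    MvPolynomial.eval (fun k : σ × n × n => X k.1 k.2.1 k.2.2)
      (charpolyDisc (FreeAlgebra.lift K (genericMatrix K n σ) f)) =
      charpolyDisc (FreeAlgebra.lift K X f) := by
  rw [← charpolyDisc_map, map_lift_genericMatrix]

theorem eval_det_generic {K : Type*} [Field K] (f : FreeAlgebra K σ)
    (X : σ → Matrix n n K) :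
    MvPolynomial.eval (fun k : σ × n × n => X k.1 k.2.1 k.2.2)
      (FreeAlgebra.lift K (genericMatrix K n σ) f).det = (FreeAlgebra.lift K X f).det := by
  rw [RingHom.map_det, RingHom.mapMatrix_apply, map_lift_genericMatrix]

end generic

namespace NCPoly

variable {K : Type*} [Field K] {m n : ℕ}

theorem mem_eigenvalueSet_iff (A : Matrix (Fin n) (Fin n) K) (z : K) :
    z ∈ eigenvalueSet A ↔ A.charpoly.IsRoot z := by
  rw [eigenvalueSet, Set.mem_ofPred_eq, Module.End.hasEigenvalue_iff_isRoot_charpoly,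
    ← Matrix.charpoly_toLin']

theorem eigenvalueSet_eq_roots [DecidableEq K] (A : Matrix (Fin n) (Fin n) K) :
    eigenvalueSet A = A.charpoly.roots.toFinset := by
  ext z
  simp [mem_eigenvalueSet_iff, A.charpoly_monic.ne_zero]

theorem mem_distinctNonzeroLocus_iff [IsAlgClosed K] (f : FreeAlgebra K (Fin m))
    (X : Fin m → Matrix (Fin n) (Fin n) K) :
    X ∈ distinctNonzeroLocus f n ↔
      (eval f X).charpoly.Separable ∧ ¬ (eval f X).charpoly.IsRoot 0 := by
  classical
  have h1 : (eval f X).charpoly.roots.toFinset.card ≤ n :=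
    (Multiset.toFinset_card_le _).trans <| (Polynomial.card_roots' _).trans <| by
      rw [Matrix.charpoly_natDegree_eq_dim, Fintype.card_fin]
  rw [charpoly_separable_iff_card_roots, Fintype.card_fin, ← mem_eigenvalueSet_iff]
  simp only [distinctNonzeroLocus, Set.mem_ofPred_eq]
  conv_lhs => rw [eigenvalueSet_eq_roots, Set.ncard_coe_finset, ← eigenvalueSet_eq_roots]
  refine and_congr ⟨fun h => h.ge, fun h => le_antisymm h1 h⟩ ⟨fun h h0 => h 0 h0 rfl, ?_⟩
  rintro h z hz rfl
  exact h hz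

theorem isZariskiOpen_distinctNonzeroLocus [IsAlgClosed K] [CharZero K]
    (f : FreeAlgebra K (Fin m)) (n : ℕ) : IsZariskiOpen (distinctNonzeroLocus f n) := by
  refine ⟨Ideal.span {charpolyDisc (FreeAlgebra.lift K (genericMatrix K (Fin n) (Fin m)) f) *
    (FreeAlgebra.lift K (genericMatrix K (Fin n) (Fin m)) f).det}, ?_⟩
  ext X
  rw [mem_distinctNonzeroLocus_iff, Set.mem_ofPred_eq, MvPolynomial.zeroLocus_span,
    isRoot_charpoly_iff_det_eq_zero, ← charpolyDisc_ne_zero_iff]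
  simp [MvPolynomial.aeval_eq_eval, eval_charpolyDisc_generic, eval_det_generic, eval]

end NCPoly

/-! ### Open conditions and lowest-order terms. -/

open Polynomial in
/-- A Zariski open condition on square matrices that is invariant under nonzero scaling and under
adding elements of a given subspace. -/
structure OpenCondition (K n : Type*) [Field K] where
  /-- The condition. -/
  holds : Matrix n n K → Prop
  /-- The subspace whose translations preserve the condition. -/
  negligible : Submodule K (Matrix n n K)
  add_negligible : ∀ A, ∀ B ∈ negligible, holds A → holds (A + B)
  smul : ∀ A, ∀ t : K, t ≠ 0 → holds A → holds (t • A)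
  exists_eval : ∀ M : Matrix n n K[X], holds (M.map (eval 0)) →
    ∃ t : K, t ≠ 0 ∧ holds (M.map (eval t))

namespace OpenCondition

variable {K n : Type*} [Field K]

/-- Terms of weight below `k` are negligible. The others, divided by `t ^ k`, form a polynomial
curve whose value at `0` is the weight-`k` part, so `exists_eval` applies. -/
theorem exists_of_lowest (O : OpenCondition K n) {ι : Type*} (s : Finset ι) (w : ι → ℕ)
    (A : ι → Matrix n n K) (k : ℕ) (hlt : ∀ a ∈ s, w a < k → A a ∈ O.negligible)
    (heq : O.holds (∑ a ∈ s with w a = k, A a)) :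
    ∃ t : K, t ≠ 0 ∧ O.holds (∑ a ∈ s, t ^ w a • A a) := by
  let M : Matrix n n (Polynomial K) :=
    ∑ a ∈ s with k ≤ w a, (Polynomial.X ^ (w a - k) : Polynomial K) • (A a).map Polynomial.C
  have hM (t : K) : M.map (Polynomial.eval t) = ∑ a ∈ s with k ≤ w a, t ^ (w a - k) • A a := by
    ext i j
    simp only [M, Matrix.map_apply, Matrix.sum_apply, Matrix.smul_apply, Polynomial.eval_finsetSum,
      smul_eq_mul, Polynomial.eval_mul, Polynomial.eval_pow, Polynomial.eval_X, Polynomial.eval_C]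
  have h0 : O.holds (M.map (Polynomial.eval 0)) := by
    rw [hM]
    convert heq using 1
    rw [Finset.sum_filter, Finset.sum_filter]
    refine Finset.sum_congr rfl fun a _ => ?_
    rcases lt_trichotomy (w a) k with h | h | h
    · rw [if_neg (by omega), if_neg (by omega)]
    · simp [h]
    · rw [if_pos (by omega), if_neg (by omega), zero_pow (by omega), zero_smul]
  obtain ⟨t, ht, hQ⟩ := O.exists_eval M h0
  refine ⟨t, ht, ?_⟩
  have hsum : ∑ a ∈ s, t ^ w a • A a =
      t ^ k • M.map (Polynomial.eval t) + ∑ a ∈ s with ¬ k ≤ w a, t ^ w a • A a := by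
    rw [← Finset.sum_filter_add_sum_filter_not s (fun a => k ≤ w a), hM, Finset.smul_sum]
    congr 1
    refine Finset.sum_congr rfl fun a ha => ?_
    rw [smul_smul, ← pow_add, Nat.add_sub_cancel' (Finset.mem_filter.mp ha).2]
  rw [hsum]
  refine O.add_negligible _ _ (Submodule.sum_mem _ fun a ha => ?_)
    (O.smul _ _ (pow_ne_zero _ ht) hQ)
  rw [Finset.mem_filter, not_le] at ha
  exact O.negligible.smul_mem _ (hlt a ha.1 ha.2)

theorem exists_of_monomials (O : OpenCondition K n) (s : Finset (ℕ × ℕ))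
    (B : ℕ × ℕ → Matrix n n K) (hB : ∀ a, B a ∈ O.negligible ∨ O.holds (B a))
    (hs : ∃ a ∈ s, B a ∉ O.negligible) :
    ∃ x y : K, O.holds (∑ a ∈ s, (x ^ a.1 * y ^ a.2) • B a) := by
  classical
  -- The lexicographically least non-negligible exponent, with the power of `y` compared first: `x`
  -- isolates it within its row, then `y` isolates the row.
  obtain ⟨a, ha, hmin⟩ := Finset.exists_min_image (s.filter fun a => B a ∉ O.negligible)
    (fun a => toLex (a.2, a.1)) (by simpa [Finset.filter_nonempty_iff] using hs)
  rw [Finset.mem_filter] at ha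
  simp only [Finset.mem_filter, Prod.Lex.toLex_le_toLex, and_imp] at hmin
  obtain ⟨x, hx, hQx⟩ := O.exists_of_lowest (s.filter fun b => b.2 = a.2) Prod.fst B a.1
    (fun b hb hlt => by
      rw [Finset.mem_filter] at hb
      by_contra hn
      rcases hmin b hb.1 hn with h | h
      · exact absurd hb.2 h.ne'
      · exact absurd h.2 hlt.not_ge)
    (by
      have : (s.filter fun b => b.2 = a.2).filter (fun b => b.1 = a.1) = {a} := by
        ext b
        simp only [Finset.mem_filter, Finset.mem_singleton, Prod.ext_iff]
        constructor
        · tauto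
        · rintro ⟨h1, h2⟩
          have : b = a := Prod.ext h1 h2
          exact ⟨⟨this ▸ ha.1, h2⟩, h1⟩
      rw [this, Finset.sum_singleton]
      exact (hB a).resolve_left ha.2)
  obtain ⟨y, hy, hQy⟩ := O.exists_of_lowest s Prod.snd (fun b => x ^ b.1 • B b) a.2
    (fun b hb hlt => by
      refine O.negligible.smul_mem _ ?_
      by_contra hn
      rcases hmin b hb hn with h | h
      · exact absurd h hlt.not_gt
      · exact absurd h.1 hlt.ne') hQx
  refine ⟨x, y, ?_⟩
  simpa [smul_smul, mul_comm] using hQy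

end OpenCondition

/-! ### Monomials in two elements commuting up to a scalar. -/

section quantumPlane

variable {K T : Type*} [Field K] [Ring T] [Algebra K T]

theorem pow_mul_pow_of_skew_commute {u v : T} {c : K} (h : v * u = c • (u * v)) (j k : ℕ) :
    v ^ j * u ^ k = c ^ (j * k) • (u ^ k * v ^ j) := by
  have h1 (k : ℕ) : v * u ^ k = c ^ k • (u ^ k * v) := by
    induction k with
    | zero => simp
    | succ k ih =>
      rw [pow_succ, ← mul_assoc, ih, smul_mul_assoc, mul_assoc, h, mul_smul_comm, smul_smul,
        ← pow_succ, ← mul_assoc]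
  induction j with
  | zero => simp
  | succ j ih =>
    rw [pow_succ, mul_assoc, h1, mul_smul_comm, ← mul_assoc, ih, smul_mul_assoc, smul_smul,
      mul_assoc, ← pow_add, Nat.succ_mul, add_comm]

/-- Products of monomials are scalar multiples of monomials, so their span is a subalgebra. -/
theorem lift_mem_span_monomials {σ : Type*} {u v : T} {c : K} (h : v * u = c • (u * v))
    (X : σ → T) (hX : ∀ k, X k ∈ Submodule.span K (Set.range fun a : ℕ × ℕ => u ^ a.1 * v ^ a.2))
    (f : FreeAlgebra K σ) : FreeAlgebra.lift K X f ∈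
      Submodule.span K (Set.range fun a : ℕ × ℕ => u ^ a.1 * v ^ a.2) := by
  set S := Submodule.span K (Set.range fun a : ℕ × ℕ => u ^ a.1 * v ^ a.2) with hS
  have h1 : (1 : T) ∈ S := Submodule.subset_span ⟨(0, 0), by simp⟩
  induction f with
  | grade0 r =>
    rw [AlgHom.commutes, Algebra.algebraMap_eq_smul_one]
    exact S.smul_mem _ h1
  | grade1 k => simpa using hX k
  | add a b ha hb => rw [map_add]; exact S.add_mem ha hb
  | mul a b ha hb =>
    rw [map_mul]
    have := Submodule.mul_mem_mul ha hb
    rw [hS, Submodule.span_mul_span] at this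
    refine Submodule.span_le.mpr ?_ this
    rintro _ ⟨_, ⟨a, rfl⟩, _, ⟨b, rfl⟩, rfl⟩
    have : u ^ a.1 * v ^ a.2 * (u ^ b.1 * v ^ b.2) =
        c ^ (a.2 * b.1) • (u ^ (a.1 + b.1) * v ^ (a.2 + b.2)) := by
      rw [mul_assoc, ← mul_assoc (v ^ a.2), pow_mul_pow_of_skew_commute h, smul_mul_assoc,
        mul_smul_comm, pow_add, pow_add]
      simp only [mul_assoc]
    simp only [this]
    exact S.smul_mem _ (Submodule.subset_span ⟨(a.1 + b.1, a.2 + b.2), rfl⟩)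

end quantumPlane

namespace OpenCondition

theorem exists_lift_of_skew_commute {K n σ : Type*} [Field K] [Fintype n] [DecidableEq n]
    (O : OpenCondition K n) {U V : Matrix n n K} {c : K} (h : V * U = c • (U * V))
    (hspan : Submodule.span K (Set.range fun a : ℕ × ℕ => U ^ a.1 * V ^ a.2) = ⊤)
    (hmono : ∀ (r : K) (i j : ℕ), r • (U ^ i * V ^ j) ∈ O.negligible ∨
      O.holds (r • (U ^ i * V ^ j)))
    (f : FreeAlgebra K σ) (X : σ → Matrix n n K) (hX : FreeAlgebra.lift K X f ∉ O.negligible) :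
    ∃ Y : σ → Matrix n n K, O.holds (FreeAlgebra.lift K Y f) := by
  have hdec (k : σ) : ∃ d : ℕ × ℕ →₀ K, (d.sum fun a r => r • (U ^ a.1 * V ^ a.2)) = X k := by
    rw [← Finsupp.mem_span_range_iff_exists_finsupp, hspan]
    trivial
  choose d hd using hdec
  -- Working in the algebra of functions of `(x, y)` gives one family of coefficients `e` valid for
  -- all `x`, `y` at once.
  let u : K × K → Matrix n n K := fun z => z.1 • U
  let v : K × K → Matrix n n K := fun z => z.2 • V
  let X' : σ → K × K → Matrix n n K := fun k => (d k).sum fun a r => r • (u ^ a.1 * v ^ a.2)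
  have hvu : v * u = c • (u * v) := by
    funext z
    simp [u, v, h, smul_smul, mul_comm, mul_left_comm]
  have hmem := lift_mem_span_monomials hvu X' (fun k => Submodule.sum_mem _ fun a _ =>
    Submodule.smul_mem _ _ (Submodule.subset_span ⟨a, rfl⟩)) f
  obtain ⟨e, he⟩ := Finsupp.mem_span_range_iff_exists_finsupp.mp hmem
  have heval (z : K × K) : FreeAlgebra.lift K (fun k => X' k z) f =
      ∑ a ∈ e.support, (z.1 ^ a.1 * z.2 ^ a.2) • e a • (U ^ a.1 * V ^ a.2) := by
    have h1 : FreeAlgebra.lift K (fun k => X' k z) =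
        (Pi.evalAlgHom K (fun _ : K × K => Matrix n n K) z).comp (FreeAlgebra.lift K X') := by
      ext k : 2
      simp
    rw [h1, AlgHom.comp_apply, ← he]
    simp [Finsupp.sum, u, v, smul_pow, smul_smul, mul_comm]
  -- At `(x, y) = (1, 1)` the sum is `f(X)` itself, which is not negligible.
  have h1 : ∃ a ∈ e.support, e a • (U ^ a.1 * V ^ a.2) ∉ O.negligible := by
    by_contra! H
    refine hX ?_
    have hX1 : X = fun k => X' k (1, 1) := by
      funext k
      rw [← hd k]
      simp [X', Finsupp.sum, u, v]
    rw [hX1, heval]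
    exact Submodule.sum_mem _ fun a ha => by simpa using H a ha
  obtain ⟨x, y, hxy⟩ := O.exists_of_monomials e.support (fun a => e a • (U ^ a.1 * V ^ a.2))
    (fun a => hmono _ _ _) h1
  exact ⟨fun k => X' k (x, y), by rw [heval]; exact hxy⟩

end OpenCondition

/-! ### Clock and shift matrices. -/

section clockShift

variable {K : Type*} [Field K]

/-- The diagonal matrix with entries the powers of `ζ`. -/
def clockMatrix (p : ℕ) (ζ : K) : Matrix (ZMod p) (ZMod p) K :=
  Matrix.diagonal fun a => ζ ^ a.val

/-- The matrix of the cyclic shift. -/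
def cyclicShift (K : Type*) [Field K] (p : ℕ) : Matrix (ZMod p) (ZMod p) K :=
  Matrix.of fun a b => if a = b + 1 then 1 else 0

variable {p : ℕ} [NeZero p]

theorem cyclicShift_pow (k : ℕ) : cyclicShift K p ^ k =
    Matrix.of fun a b => if a = b + (k : ZMod p) then 1 else 0 := by
  induction k with
  | zero => ext a b; simp [Matrix.one_apply]
  | succ k ih =>
    rw [pow_succ, ih]
    ext a b
    simp [Matrix.mul_apply, cyclicShift, add_comm, add_left_comm]

theorem cyclicShift_pow_self : cyclicShift K p ^ p = 1 := by
  rw [cyclicShift_pow]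
  ext a b
  simp [Matrix.one_apply]

theorem clockMatrix_pow_self {ζ : K} (hζ : ζ ^ p = 1) : clockMatrix p ζ ^ p = 1 := by
  rw [clockMatrix, Matrix.diagonal_pow, ← Matrix.diagonal_one]
  congr 1
  funext a
  simp [← pow_mul, mul_comm a.val, pow_mul ζ p, hζ]

theorem pow_val_add_one {ζ : K} (hζ : ζ ^ p = 1) (a : ZMod p) :
    ζ ^ (a + 1).val = ζ ^ a.val * ζ := by
  rw [← pow_succ, ← Nat.cast_one, ← ZMod.natCast_zmod_val a, ← Nat.cast_add, ZMod.val_natCast,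
    ZMod.natCast_zmod_val, ← pow_eq_pow_mod _ hζ]

theorem clockMatrix_mul_cyclicShift {ζ : K} (hζ : ζ ^ p = 1) :
    clockMatrix p ζ * cyclicShift K p = ζ • (cyclicShift K p * clockMatrix p ζ) := by
  ext a b
  by_cases h : a = b + 1
  · simp [clockMatrix, cyclicShift, h, pow_val_add_one hζ, mul_comm]
  · simp [clockMatrix, cyclicShift, h]

theorem span_clockMatrix_mul_cyclicShift {ζ : K} (hζ : IsPrimitiveRoot ζ p) :
    Submodule.span K (Set.range fun a : ℕ × ℕ =>
      clockMatrix p ζ ^ a.1 * cyclicShift K p ^ a.2) = ⊤ := by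
  rw [eq_top_iff]
  rintro A -
  -- The clock has distinct diagonal entries, so Lagrange interpolation makes every diagonal matrix
  -- a polynomial in it.
  have hdiag (c : ZMod p → K) : ∃ P : Polynomial K,
      Polynomial.aeval (clockMatrix p ζ) P = Matrix.diagonal c := by
    refine ⟨Lagrange.interpolate Finset.univ (fun a : ZMod p => ζ ^ a.val) c, ?_⟩
    have : clockMatrix p ζ = Matrix.diagonalAlgHom K (fun a : ZMod p => ζ ^ a.val) := rfl
    rw [this, Polynomial.aeval_algHom_apply, Matrix.diagonalAlgHom_apply]
    congr 1
    funext a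
    rw [Polynomial.aeval_pi_apply₂ (R := K)]
    simp only [Polynomial.coe_aeval_eq_eval]
    refine Lagrange.eval_interpolate_at_node (v := fun a : ZMod p => ζ ^ a.val) c ?_
      (Finset.mem_univ a)
    intro x _ y _ hxy
    exact ZMod.val_injective p (hζ.pow_inj (ZMod.val_lt x) (ZMod.val_lt y) hxy)
  have hA : A = ∑ k : ZMod p, Matrix.diagonal (fun a => A a (a - k)) * cyclicShift K p ^ k.val := by
    ext a b
    rw [Matrix.sum_apply, Finset.sum_eq_single (a - b)]
    · simp [cyclicShift_pow]
    · intro k _ hk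
      have : a ≠ b + k := fun h => hk (by rw [h]; ring)
      simp [cyclicShift_pow, this]
    · simp
  rw [hA]
  refine Submodule.sum_mem _ fun k _ => ?_
  obtain ⟨P, hP⟩ := hdiag fun a => A a (a - k)
  rw [← hP, Polynomial.aeval_eq_sum_range, Finset.sum_mul]
  refine Submodule.sum_mem _ fun i _ => ?_
  rw [smul_mul_assoc]
  exact Submodule.smul_mem _ _ (Submodule.subset_span ⟨(i, k.val), rfl⟩)

end clockShift

/-- An invertible matrix that is conjugate to its multiple by a primitive root of unity of order
the size of the matrix has separable characteristic polynomial. -/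
theorem charpoly_separable_of_skew_commute {K n : Type*} [Field K] [IsAlgClosed K] [Fintype n]
    [DecidableEq n] {ω : K} (hω : IsPrimitiveRoot ω (Fintype.card n)) {A Z : Matrix n n K}
    (hA : A.det ≠ 0) (hZ : Z.det ≠ 0) (h : Z * A = ω • (A * Z)) : A.charpoly.Separable := by
  classical
  cases isEmpty_or_nonempty n
  · rw [Matrix.charpoly, Matrix.det_isEmpty]
    exact Polynomial.separable_one
  have hcard : Fintype.card n ≠ 0 := Fintype.card_ne_zero
  have hω0 : ω ≠ 0 := hω.ne_zero hcard
  -- Conjugation by `Z` makes the spectrum stable under `ω⁻¹`; the orbit of one nonzero root then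
  -- has as many elements as the size of the matrix.
  have hstep (z : K) (hz : A.charpoly.IsRoot z) : A.charpoly.IsRoot (ω⁻¹ * z) := by
    rw [isRoot_charpoly_iff_det_eq_zero] at hz ⊢
    have h1 : Z * (A - algebraMap K _ z) = (ω • (A - algebraMap K _ (ω⁻¹ * z))) * Z := by
      simp only [Algebra.algebraMap_eq_smul_one, mul_sub, sub_mul, smul_sub, smul_mul_assoc, h,
        mul_smul_comm, smul_smul, mul_one, one_mul]
      rw [mul_inv_cancel_left₀ hω0]
    have h2 := congr_arg Matrix.det h1
    rw [Matrix.det_mul, Matrix.det_mul, Matrix.det_smul, hz, mul_zero] at h2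
    simpa [hω0, hZ] using h2.symm
  obtain ⟨z, hz⟩ := IsAlgClosed.exists_root A.charpoly (by
    rw [Polynomial.degree_eq_natDegree A.charpoly_monic.ne_zero, A.charpoly_natDegree_eq_dim]
    exact_mod_cast hcard)
  have hz0 : z ≠ 0 := by
    rintro rfl
    rw [isRoot_charpoly_iff_det_eq_zero] at hz
    simp [hA] at hz
  have hpow (k : ℕ) : A.charpoly.IsRoot (ω⁻¹ ^ k * z) := by
    induction k with
    | zero => simpa using hz
    | succ k ih => rw [pow_succ', mul_assoc]; exact hstep _ ih
  rw [charpoly_separable_iff_card_roots, ← Finset.card_range (Fintype.card n)]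
  refine Finset.card_le_card_of_injOn (fun k => ω⁻¹ ^ k * z) (fun k _ => ?_) ?_
  · simpa [A.charpoly_monic.ne_zero] using hpow k
  · intro a ha b hb hab
    exact hω.inv.pow_inj (by simpa using ha) (by simpa using hb) (mul_right_cancel₀ hz0 hab)

/-! ### The two open conditions, and values in prime size. -/

section conditions

variable (K n : Type*) [Field K] [IsAlgClosed K] [CharZero K] [Fintype n] [DecidableEq n]

/-- Invertibility of a matrix. -/
def OpenCondition.det : OpenCondition K n where
  holds A := A.det ≠ 0
  negligible := ⊥
  add_negligible A B hB hA := by rwa [(Submodule.mem_bot K).mp hB, add_zero]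
  smul A t ht hA := by
    rw [Matrix.det_smul]
    exact mul_ne_zero (pow_ne_zero _ ht) hA
  exists_eval M hM := by
    have h (t : K) : (M.map (Polynomial.eval t)).det = M.det.eval t := by
      rw [← Polynomial.coe_evalRingHom, RingHom.map_det, RingHom.mapMatrix_apply]
    simp only [h] at hM ⊢
    exact exists_ne_zero_eval_ne_zero _ hM

/-- Having distinct eigenvalues. -/
def OpenCondition.distinctEigenvalues : OpenCondition K n where
  holds A := A.charpoly.Separable
  negligible := Submodule.span K {1}
  add_negligible A B hB hA := by
    classical
    obtain ⟨r, rfl⟩ := Submodule.mem_span_singleton.mp hB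
    rw [charpoly_separable_iff_card_roots] at hA ⊢
    refine hA.trans (Finset.card_le_card_of_injOn (fun z => z + r) (fun z hz => ?_)
      (add_left_injective r).injOn)
    simp only [Finset.mem_coe, Multiset.mem_toFinset, ne_eq, Matrix.charpoly_monic,
      Polynomial.Monic.ne_zero, not_false_eq_true, Polynomial.mem_roots,
      isRoot_charpoly_iff_det_eq_zero] at hz ⊢
    rw [← hz, map_add, Algebra.algebraMap_eq_smul_one r, add_sub_add_right_eq_sub]
  smul A t ht hA := by
    classical
    rw [charpoly_separable_iff_card_roots] at hA ⊢
    refine hA.trans (Finset.card_le_card_of_injOn (fun z => t * z) (fun z hz => ?_)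
      (mul_right_injective₀ ht).injOn)
    simp only [Finset.mem_coe, Multiset.mem_toFinset, ne_eq, Matrix.charpoly_monic,
      Polynomial.Monic.ne_zero, not_false_eq_true, Polynomial.mem_roots,
      isRoot_charpoly_iff_det_eq_zero] at hz ⊢
    rw [map_mul, ← Algebra.smul_def, ← smul_sub, Matrix.det_smul, hz, mul_zero]
  exists_eval M hM := by
    have h (t : K) : (M.map (Polynomial.eval t)).charpoly.Separable ↔
        (charpolyDisc M).eval t ≠ 0 := by
      rw [← charpolyDisc_ne_zero_iff, ← Polynomial.coe_evalRingHom, charpolyDisc_map]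
    simp only [h] at hM ⊢
    exact exists_ne_zero_eval_ne_zero _ hM

end conditions

section clockShift

variable {K σ : Type*} [Field K] {p : ℕ}

theorem det_ne_zero_of_pow_eq_one {n : Type*} [Fintype n] [DecidableEq n] {A : Matrix n n K}
    {k : ℕ} (hk : k ≠ 0) (h : A ^ k = 1) : A.det ≠ 0 := by
  intro h0
  have := congr_arg Matrix.det h
  simp [h0, hk] at this

/-- `U ^ i * V ^ j` commutes with `U` up to `ζ ^ j` and with `V` up to `(ζ ^ i)⁻¹`. As `p` is prime,
one of these scalars is a primitive `p`-th root of unity. -/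
theorem charpoly_separable_clockMatrix_mul_cyclicShift [IsAlgClosed K] (hp : p.Prime) [NeZero p] {ζ : K}
    (hζ : IsPrimitiveRoot ζ p) {i j : ℕ} (hij : ¬ (p ∣ i ∧ p ∣ j)) {r : K} (hr : r ≠ 0) :
    (r • (clockMatrix p ζ ^ i * cyclicShift K p ^ j)).charpoly.Separable := by
  have hU := det_ne_zero_of_pow_eq_one hp.ne_zero (clockMatrix_pow_self hζ.pow_eq_one)
  have hV := det_ne_zero_of_pow_eq_one hp.ne_zero (cyclicShift_pow_self (K := K) (p := p))
  have hUV := clockMatrix_mul_cyclicShift hζ.pow_eq_one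
  set U := clockMatrix p ζ
  set V := cyclicShift K p
  have hA : (r • (U ^ i * V ^ j)).det ≠ 0 := by
    simp [hr, hU, hV]
  have hcard : Fintype.card (ZMod p) = p := ZMod.card p
  by_cases hj : p ∣ j
  · have hi : ¬ p ∣ i := fun hi => hij ⟨hi, hj⟩
    refine charpoly_separable_of_skew_commute (ω := (ζ ^ i)⁻¹) (Z := V) ?_ hA hV ?_
    · rw [hcard]
      exact (hζ.pow_of_coprime i (hp.coprime_iff_not_dvd.mpr hi).symm).inv
    · have h1 : U ^ i * V = ζ ^ i • (V * U ^ i) := by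
        have := pow_mul_pow_of_skew_commute hUV i 1
        simpa using this
      have h2 : V * U ^ i = (ζ ^ i)⁻¹ • (U ^ i * V) := by
        rw [h1, smul_smul, inv_mul_cancel₀ (pow_ne_zero _ (hζ.ne_zero hp.ne_zero)), one_smul]
      rw [mul_smul_comm, ← mul_assoc, h2, smul_mul_assoc, smul_mul_assoc, mul_assoc, mul_assoc,
        ← pow_succ, ← pow_succ', smul_comm]
  · refine charpoly_separable_of_skew_commute (ω := ζ ^ j) (Z := U) ?_ hA hU ?_
    · rw [hcard]
      exact hζ.pow_of_coprime j (hp.coprime_iff_not_dvd.mpr hj).symm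
    · have h1 : U * V ^ j = ζ ^ j • (V ^ j * U) := by
        have := pow_mul_pow_of_skew_commute hUV 1 j
        simpa using this
      rw [mul_smul_comm, ← mul_assoc, ← pow_succ', pow_succ, mul_assoc, h1, mul_smul_comm,
        smul_mul_assoc, mul_assoc, smul_comm]

theorem clockMatrix_pow_mul_cyclicShift_pow_eq_one [NeZero p] {ζ : K}
    (hζ : ζ ^ p = 1) {i j : ℕ} (hi : p ∣ i) (hj : p ∣ j) :
    clockMatrix p ζ ^ i * cyclicShift K p ^ j = 1 := by
  obtain ⟨a, rfl⟩ := hi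
  obtain ⟨b, rfl⟩ := hj
  rw [pow_mul, pow_mul, clockMatrix_pow_self hζ, cyclicShift_pow_self, one_pow, one_pow, one_mul]

theorem exists_lift_of_clock_shift (hp : p.Prime) {ζ : K} (hζ : IsPrimitiveRoot ζ p)
    (O : OpenCondition K (ZMod p)) [NeZero p]
    (hmono : ∀ (r : K) (i j : ℕ), r • (clockMatrix p ζ ^ i * cyclicShift K p ^ j) ∈ O.negligible ∨
      O.holds (r • (clockMatrix p ζ ^ i * cyclicShift K p ^ j)))
    (f : FreeAlgebra K σ) (X : σ → Matrix (ZMod p) (ZMod p) K)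
    (hX : FreeAlgebra.lift K X f ∉ O.negligible) :
    ∃ Y : σ → Matrix (ZMod p) (ZMod p) K, O.holds (FreeAlgebra.lift K Y f) := by
  refine O.exists_lift_of_skew_commute (c := ζ⁻¹) ?_ (span_clockMatrix_mul_cyclicShift hζ) hmono
    f X hX
  rw [clockMatrix_mul_cyclicShift hζ.pow_eq_one, smul_smul,
    inv_mul_cancel₀ (hζ.ne_zero hp.ne_zero), one_smul]

/-- A noncommutative polynomial that takes a nonscalar value on matrices of prime size takes
values with distinct eigenvalues there, avoiding any given finite set of eigenvalues. -/
theorem exists_charpoly_separable_of_nonscalar [IsAlgClosed K] [CharZero K] (hp : p.Prime) [NeZero p]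
    (f : FreeAlgebra K σ) (X : σ → Matrix (ZMod p) (ZMod p) K)
    (hX : FreeAlgebra.lift K X f ∉ Submodule.span K {(1 : Matrix (ZMod p) (ZMod p) K)})
    (s : Finset K) :
    ∃ Y : σ → Matrix (ZMod p) (ZMod p) K, (FreeAlgebra.lift K Y f).charpoly.Separable ∧
      ∀ z ∈ s, ¬ (FreeAlgebra.lift K Y f).charpoly.IsRoot z := by
  have : NeZero (p : K) := ⟨Nat.cast_ne_zero.mpr hp.ne_zero⟩
  obtain ⟨ζ, hζ⟩ := HasEnoughRootsOfUnity.exists_primitiveRoot K p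
  obtain ⟨Y, hY⟩ : ∃ Y : σ → Matrix (ZMod p) (ZMod p) K,
      (FreeAlgebra.lift K Y f).charpoly.Separable := by
    refine exists_lift_of_clock_shift hp hζ (OpenCondition.distinctEigenvalues K (ZMod p))
      (fun r i j => ?_) f X hX
    rcases eq_or_ne r 0 with rfl | hr
    · left; simp
    by_cases hij : p ∣ i ∧ p ∣ j
    · left
      rw [clockMatrix_pow_mul_cyclicShift_pow_eq_one hζ.pow_eq_one hij.1 hij.2]
      exact Submodule.smul_mem _ _ (Submodule.mem_span_singleton_self _)
    · right
      exact charpoly_separable_clockMatrix_mul_cyclicShift hp hζ hij hr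
  -- All nonzero multiples of monomials are invertible, and `f - z` is nonzero at `X` because `f(X)`
  -- is not scalar.
  have hdet (z : K) : ∃ Y : σ → Matrix (ZMod p) (ZMod p) K,
      (FreeAlgebra.lift K Y (f - algebraMap K _ z)).det ≠ 0 := by
    refine exists_lift_of_clock_shift hp hζ (OpenCondition.det K (ZMod p))
      (fun r i j => ?_) (f - algebraMap K _ z) X ?_
    · rcases eq_or_ne r 0 with rfl | hr
      · left; simp
      · right
        have hU := det_ne_zero_of_pow_eq_one hp.ne_zero (clockMatrix_pow_self hζ.pow_eq_one)
        have hV := det_ne_zero_of_pow_eq_one hp.ne_zero (cyclicShift_pow_self (K := K) (p := p))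
        simp [OpenCondition.det, hr, hU, hV]
    · intro h
      rw [OpenCondition.det, Submodule.mem_bot, map_sub, AlgHom.commutes, sub_eq_zero] at h
      rw [h, Algebra.algebraMap_eq_smul_one] at hX
      exact hX (Submodule.smul_mem _ _ (Submodule.mem_span_singleton_self _))
  -- Each requirement is the nonvanishing of a nonzero polynomial; their product is nonzero, so one
  -- point meets them all.
  let P : MvPolynomial (σ × ZMod p × ZMod p) K :=
    charpolyDisc (FreeAlgebra.lift K (genericMatrix K (ZMod p) σ) f) *
      ∏ z ∈ s, (FreeAlgebra.lift K (genericMatrix K (ZMod p) σ) (f - algebraMap K _ z)).det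
  have hP : P ≠ 0 := by
    refine mul_ne_zero (fun h => ?_) (Finset.prod_ne_zero_iff.mpr fun z _ h => ?_)
    · rw [← charpolyDisc_ne_zero_iff, ← eval_charpolyDisc_generic, h] at hY
      simp at hY
    · obtain ⟨Y, hY⟩ := hdet z
      rw [← eval_det_generic, h] at hY
      simp at hY
  obtain ⟨y, hy⟩ : ∃ y, MvPolynomial.eval y P ≠ 0 := by
    by_contra! H
    exact hP (MvPolynomial.funext fun y => by rw [H y, map_zero])
  let Y : σ → Matrix (ZMod p) (ZMod p) K := fun k => Matrix.of fun i j => y (k, i, j)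
  have hyY : y = fun k : σ × ZMod p × ZMod p => Y k.1 k.2.1 k.2.2 := rfl
  rw [map_mul, map_prod, hyY, eval_charpolyDisc_generic] at hy
  simp only [eval_det_generic] at hy
  refine ⟨Y, (charpolyDisc_ne_zero_iff _).mp (left_ne_zero_of_mul hy), fun z hz => ?_⟩
  rw [isRoot_charpoly_iff_det_eq_zero]
  have := Finset.prod_ne_zero_iff.mp (right_ne_zero_of_mul hy) z hz
  rwa [map_sub, AlgHom.commutes] at this

end clockShift

/-! ### Polarization by alternating sums. -/

section polarization

/-- If some `j` lies outside `T`, toggling `j` in `S` cancels the terms in pairs. -/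
theorem sum_powerset_neg_one_pow_subset {α : Type*} [Fintype α] [DecidableEq α] (R : Type*) [Ring R]
    (T : Finset α) :
    ∑ S : Finset α, (if T ⊆ S then (-1 : R) ^ S.card else 0) =
      if T = Finset.univ then (-1) ^ Fintype.card α else 0 := by
  split_ifs with h
  · subst h
    simp [Finset.univ_subset_iff, Finset.card_univ]
  · obtain ⟨j, hj⟩ : ∃ j, j ∉ T := by
      by_contra! H
      exact h (Finset.eq_univ_iff_forall.mpr H)
    refine Finset.sum_involution (fun S _ => if j ∈ S then S.erase j else insert j S) ?_ ?_ ?_ ?_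
    · intro S _
      by_cases hS : j ∈ S
      · have h1 : T ⊆ S.erase j ↔ T ⊆ S := by
          rw [Finset.subset_erase]
          simp [hj]
        have h2 : S.card = (S.erase j).card + 1 := (Finset.card_erase_add_one hS).symm
        simp only [hS, if_true, h1]
        split_ifs
        · rw [h2, pow_succ]; simp
        · simp
      · have h1 : T ⊆ insert j S ↔ T ⊆ S := Finset.subset_insert_iff_of_notMem hj
        simp only [hS, if_false, h1]
        split_ifs
        · rw [Finset.card_insert_of_notMem hS, pow_succ]; simp
        · simp
    · intro S _ _ he
      by_cases hS : j ∈ S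
      · simp only [hS, if_true] at he
        exact Finset.notMem_erase j S (he.symm ▸ hS)
      · simp only [hS, if_false] at he
        exact hS (he ▸ Finset.mem_insert_self j S)
    · intro S _; exact Finset.mem_univ _
    · intro S _
      by_cases hS : j ∈ S
      · simp [hS]
      · simp [hS]

/-- The multilinear part of a product of sums is extracted by an alternating sum over subsets. -/
theorem sum_neg_one_pow_prod_ofFn {K A : Type*} [Field K] [Ring A] [Algebra K A] {σ : Type*}
    [DecidableEq σ] {d l : ℕ} (w : Fin d → σ) (E : Fin d → A) (g : Fin l → σ) :
    ∑ S : Finset (Fin d), (-1 : K) ^ S.card • (List.ofFn fun s => ∑ j,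
        (if j ∈ S ∧ w j = g s then (1 : K) else 0) • E j).prod =
      ∑ φ : Fin l → Fin d, (if Finset.univ.image φ = Finset.univ ∧ w ∘ φ = g then (-1 : K) ^ d else 0) •
        (List.ofFn fun s => E (φ s)).prod := by
  -- Multilinear expansion: `φ` records the summand chosen in each factor.
  have h1 (S : Finset (Fin d)) : (List.ofFn fun s => ∑ j,
        (if j ∈ S ∧ w j = g s then (1 : K) else 0) • E j).prod = ∑ φ : Fin l → Fin d,
        (if Finset.univ.image φ ⊆ S ∧ w ∘ φ = g then (1 : K) else 0) •
        (List.ofFn fun s => E (φ s)).prod := by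
    rw [← MultilinearMap.mkPiAlgebraFin_apply (R := K), MultilinearMap.map_sum]
    refine Finset.sum_congr rfl fun φ _ => ?_
    rw [MultilinearMap.map_smul_univ, MultilinearMap.mkPiAlgebraFin_apply, Finset.prod_ite_zero,
      Finset.prod_const_one]
    congr 2
    simp [Finset.image_subset_iff, forall_and, funext_iff]
  simp only [h1, Finset.smul_sum]
  rw [Finset.sum_comm]
  refine Finset.sum_congr rfl fun φ _ => ?_
  simp only [smul_smul]
  rw [← Finset.sum_smul]
  congr 1
  by_cases hg : w ∘ φ = g
  · simpa [hg] using sum_powerset_neg_one_pow_subset K (Finset.univ.image φ)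
  · simp [hg]

end polarization

/-! ### Staircase products of matrix units. -/

section staircase

/-- The staircase of matrix units `e₀₁, e₁₁, e₁₂, e₂₂, …`. -/
def staircase (K : Type*) [Field K] (n : ℕ) [NeZero n] (j : ℕ) : Matrix (Fin n) (Fin n) K :=
  Matrix.single (Fin.ofNat n ((j + 1) / 2)) (Fin.ofNat n (j / 2 + 1)) 1

variable {K : Type*} [Field K] {n : ℕ} [NeZero n]

theorem prod_staircase_range (k : ℕ) : ((List.range (k + 1)).map (staircase K n)).prod =
    Matrix.single (Fin.ofNat n 0) (Fin.ofNat n (k / 2 + 1)) 1 := by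
  induction k with
  | zero => simp [staircase]
  | succ k ih =>
    rw [List.range_succ, List.map_append, List.prod_append, ih]
    have : (k + 1 + 1) / 2 = k / 2 + 1 := by omega
    simp [staircase, this]

/-- Adjacent units with indices `a`, `b` have nonzero product only if `a / 2 + 1 = (b + 1) / 2`,
which forces `a ≤ b`. Equality does occur, as `e₁₁` is idempotent. The bound `hL` keeps `Fin.ofNat`
from wrapping around. -/
theorem isChain_of_prod_staircase_ne_zero (L : List ℕ) (hL : ∀ j ∈ L, j / 2 + 1 < n)
    (h : (L.map (staircase K n)).prod ≠ 0) : L.IsChain (· ≤ ·) := by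
  induction L with
  | nil => exact List.IsChain.nil
  | cons a L ih =>
    have h1 : (L.map (staircase K n)).prod ≠ 0 := by
      intro h0
      rw [List.map_cons, List.prod_cons, h0, mul_zero] at h
      exact h rfl
    have ih' := ih (fun j hj => hL j (List.mem_cons_of_mem _ hj)) h1
    cases L with
    | nil => exact List.IsChain.singleton _
    | cons b L =>
      refine List.IsChain.cons_cons ?_ ih'
      by_contra hab
      apply h
      have ha := hL a (by simp)
      have hb := hL b (by simp)
      have hne : Fin.ofNat n (a / 2 + 1) ≠ Fin.ofNat n ((b + 1) / 2) := by
        intro he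
        have := congr_arg Fin.val he
        simp only [Fin.val_ofNat] at this
        rw [Nat.mod_eq_of_lt ha, Nat.mod_eq_of_lt (by omega)] at this
        omega
      have hz : staircase K n a * staircase K n b = 0 :=
        Matrix.single_mul_single_of_ne _ _ _ _ hne _
      rw [List.map_cons, List.map_cons, List.prod_cons, List.prod_cons, ← mul_assoc, hz, zero_mul]

/-- Among the words of length at most `d`, only `w` contributes to the alternating sum. -/
theorem sum_neg_one_pow_staircase {σ : Type*} [DecidableEq σ] {d l : ℕ} (w : Fin (d + 1) → σ)
    (hd : d / 2 + 1 < n) (hl : l ≤ d + 1) (g : Fin l → σ) :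
    ∑ S : Finset (Fin (d + 1)), (-1 : K) ^ S.card • (List.ofFn fun s => ∑ j,
        (if j ∈ S ∧ w j = g s then (1 : K) else 0) • staircase K n j).prod =
      if List.ofFn g = List.ofFn w then
        (-1 : K) ^ (d + 1) • Matrix.single (Fin.ofNat n 0) (Fin.ofNat n (d / 2 + 1)) 1 else 0 := by
  rw [sum_neg_one_pow_prod_ofFn w (fun j => staircase K n j) g]
  have hprod (φ : Fin l → Fin (d + 1)) : (List.ofFn fun s => staircase K n (φ s)) =
      (List.ofFn fun s => (φ s : ℕ)).map (staircase K n) := by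
    rw [List.map_ofFn]; rfl
  -- Surjectivity and `l ≤ d + 1` make `φ` a bijection, which excludes repeats; an increasing
  -- bijection is the identity.
  have key (φ : Fin l → Fin (d + 1)) (h1 : Finset.univ.image φ = Finset.univ)
      (h2 : (List.ofFn fun s => staircase K n (φ s)).prod ≠ 0) : l = d + 1 ∧ ∀ s, (φ s : ℕ) = s := by
    have hsurj : Function.Surjective φ := by
      intro j
      have := Finset.mem_univ j
      rw [← h1] at this
      simpa using this
    have hl' : l = d + 1 := le_antisymm hl (by simpa using Fintype.card_le_of_surjective φ hsurj)
    subst hl'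
    refine ⟨rfl, ?_⟩
    have hinj : Function.Injective φ := Finite.injective_iff_surjective.mpr hsurj
    rw [hprod] at h2
    have hch := isChain_of_prod_staircase_ne_zero _ (fun j hj => by
      obtain ⟨s, rfl⟩ := List.mem_ofFn.mp hj
      have := (φ s).2
      omega) h2
    rw [List.isChain_iff_pairwise, List.pairwise_ofFn] at hch
    have hmono : StrictMono φ := fun a b hab => lt_of_le_of_ne (hch hab) (hinj.ne hab.ne)
    have hid : φ = id := by
      refine hmono.range_inj strictMono_id |>.mp ?_
      rw [hsurj.range_eq, Set.range_id]
    intro s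
    rw [hid]; rfl
  split_ifs with hg
  · have hl' : l = d + 1 := by simpa using congr_arg List.length hg
    subst hl'
    have hg' : g = w := List.ofFn_injective hg
    subst hg'
    rw [Finset.sum_eq_single id]
    · rw [if_pos ⟨by simp, rfl⟩, hprod, ← prod_staircase_range]
      congr 3
      exact List.ext_getElem (by simp) fun i h1 h2 => by simp only [List.getElem_ofFn,
        List.getElem_range, id]
    · intro φ _ hφ
      by_contra h
      rw [smul_eq_zero, not_or] at h
      refine hφ (funext fun s => Fin.ext ?_)
      exact (key φ (by by_contra hh; simp [hh] at h) h.2).2 s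
    · simp
  · refine Finset.sum_eq_zero fun φ _ => ?_
    by_contra h
    rw [smul_eq_zero, not_or] at h
    have h1 : Finset.univ.image φ = Finset.univ ∧ w ∘ φ = g := by
      by_contra hh; simp [hh] at h
    obtain ⟨hl', hφ⟩ := key φ h1.1 h.2
    subst hl'
    refine hg ?_
    rw [← h1.2]
    congr 1
    funext s
    exact congr_arg w (Fin.ext (hφ s))

theorem sum_neg_one_pow_staircase_list {σ : Type*} [DecidableEq σ] {d : ℕ} (w : Fin (d + 1) → σ)
    (hd : d / 2 + 1 < n) (v : List σ) (hv : v.length ≤ d + 1) :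
    ∑ S : Finset (Fin (d + 1)), (-1 : K) ^ S.card • (v.map fun k => ∑ j,
        (if j ∈ S ∧ w j = k then (1 : K) else 0) • staircase K n j).prod =
      if v = List.ofFn w then
        (-1 : K) ^ (d + 1) • Matrix.single (Fin.ofNat n 0) (Fin.ofNat n (d / 2 + 1)) 1 else 0 := by
  have h := sum_neg_one_pow_staircase (K := K) (n := n) w hd hv v.get
  rw [List.ofFn_get] at h
  rw [← h]
  refine Finset.sum_congr rfl fun S _ => ?_
  congr 2
  conv_lhs => rw [← List.ofFn_get v, List.map_ofFn]
  rfl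

end staircase

/-! ### Nonscalar values of polynomials of small degree. -/

namespace NCPoly

variable {K : Type*} [Field K] {m : ℕ}

theorem lift_eq_sum {A : Type*} [Ring A] [Algebra K A] (f : FreeAlgebra K (Fin m)) (X : Fin m → A) :
    FreeAlgebra.lift K X f = ∑ w ∈ (FreeAlgebra.equivMonoidAlgebraFreeMonoid f).coeff.support,
      (FreeAlgebra.equivMonoidAlgebraFreeMonoid f).coeff w • (w.toList.map X).prod := by
  have h : FreeAlgebra.lift K X = (MonoidAlgebra.lift K A (FreeMonoid (Fin m))
      (FreeMonoid.lift X)).comp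
        (FreeAlgebra.equivMonoidAlgebraFreeMonoid (R := K) (X := Fin m)).toAlgHom := by
    ext k
    simp [FreeAlgebra.equivMonoidAlgebraFreeMonoid]
  rw [h, AlgHom.comp_apply, MonoidAlgebra.lift_apply, Finsupp.sum]
  simp only [FreeMonoid.lift_apply]
  rfl

theorem exists_word_length_eq_deg {f : FreeAlgebra K (Fin m)} (hf : Nonconstant f) :
    deg f ≠ 0 ∧ ∃ w, (FreeAlgebra.equivMonoidAlgebraFreeMonoid f).coeff w ≠ 0 ∧
      FreeMonoid.length w = deg f := by
  set F := FreeAlgebra.equivMonoidAlgebraFreeMonoid f with hF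
  have h1 : deg f ≠ 0 := by
    intro h0
    refine hf ?_
    have hsupp (w) (hw : w ∈ F.coeff.support) : w = 1 := by
      have h2 := Finset.le_sup (f := FreeMonoid.length) hw
      rw [← FreeMonoid.length_eq_zero]
      exact Nat.le_zero.mp (h2.trans h0.le)
    refine ⟨F.coeff 1, ?_⟩
    apply FreeAlgebra.equivMonoidAlgebraFreeMonoid.injective
    rw [AlgEquiv.commutes, ← hF]
    ext w
    by_cases hw : w = 1
    · subst hw; simp
    · have : F.coeff w = 0 := by
        by_contra h
        exact hw (hsupp w (Finsupp.mem_support_iff.mpr h))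
      rw [this]
      simp [Ne.symm hw]
  refine ⟨h1, ?_⟩
  have hne : F.coeff.support.Nonempty := by
    by_contra h
    rw [Finset.not_nonempty_iff_eq_empty] at h
    exact h1 (by rw [deg, ← hF, h]; rfl)
  obtain ⟨w, hw, h⟩ := Finset.exists_mem_eq_sup _ hne FreeMonoid.length
  exact ⟨w, Finsupp.mem_support_iff.mp hw, h.symm⟩

/-- A nonconstant noncommutative polynomial of degree at most `2n - 2` takes a nonscalar value on
`n × n` matrices. -/
theorem exists_eval_nonscalar {n : ℕ} {f : FreeAlgebra K (Fin m)} (hf : Nonconstant f)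
    (hn : deg f + 2 ≤ 2 * n) : ∃ X : Fin m → Matrix (Fin n) (Fin n) K,
      FreeAlgebra.lift K X f ∉ Submodule.span K {(1 : Matrix (Fin n) (Fin n) K)} := by
  classical
  obtain ⟨hd0, w, hw, hwd⟩ := exists_word_length_eq_deg hf
  obtain ⟨d, hd⟩ := Nat.exists_eq_succ_of_ne_zero hd0
  have : NeZero n := ⟨by omega⟩
  obtain ⟨w', hw'⟩ : ∃ w' : Fin (d + 1) → Fin m, List.ofFn w' = w.toList := by
    have hwl : w.toList.length = d + 1 := hwd.trans hd
    exact ⟨fun j => w.toList.get (j.cast hwl.symm), List.ext_getElem (by simp [hwl])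
      fun i h1 h2 => by simp only [List.getElem_ofFn, List.get_eq_getElem, Fin.val_cast]⟩
  by_contra! H
  let Y : Finset (Fin (d + 1)) → Fin m → Matrix (Fin n) (Fin n) K := fun S k =>
    ∑ j, (if j ∈ S ∧ w' j = k then (1 : K) else 0) • staircase K n j
  -- Were all values scalar, so would be this alternating sum; yet it is a nonzero multiple of an
  -- off-diagonal matrix unit.
  have hmem : ∑ S : Finset (Fin (d + 1)), (-1 : K) ^ S.card • FreeAlgebra.lift K (Y S) f ∈
      Submodule.span K {(1 : Matrix (Fin n) (Fin n) K)} :=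
    Submodule.sum_mem _ fun S _ => Submodule.smul_mem _ _ (H (Y S))
  have hword (v : FreeMonoid (Fin m)) (hv : FreeMonoid.length v ≤ deg f) :
      ∑ S : Finset (Fin (d + 1)), (-1 : K) ^ S.card • (v.toList.map (Y S)).prod =
        if v = w then (-1 : K) ^ (d + 1) •
          Matrix.single (Fin.ofNat n 0) (Fin.ofNat n (d / 2 + 1)) (1 : K) else 0 := by
    have h := sum_neg_one_pow_staircase_list (K := K) (n := n) w' (by omega) v.toList (hv.trans hd.le)
    rw [hw'] at h
    simpa only [FreeMonoid.toList.injective.eq_iff] using h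
  have hval : ∑ S : Finset (Fin (d + 1)), (-1 : K) ^ S.card • FreeAlgebra.lift K (Y S) f =
      ((FreeAlgebra.equivMonoidAlgebraFreeMonoid f).coeff w * (-1 : K) ^ (d + 1)) •
        Matrix.single (Fin.ofNat n 0) (Fin.ofNat n (d / 2 + 1)) 1 := by
    simp only [lift_eq_sum, Finset.smul_sum]
    rw [Finset.sum_comm, Finset.sum_eq_single w]
    · simp only [smul_comm _ ((FreeAlgebra.equivMonoidAlgebraFreeMonoid f).coeff w)]
      rw [← Finset.smul_sum, hword w hwd.le, if_pos rfl, smul_smul]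
    · intro v hv hvw
      simp only [smul_comm _ ((FreeAlgebra.equivMonoidAlgebraFreeMonoid f).coeff v)]
      rw [← Finset.smul_sum, hword v, if_neg hvw, smul_zero]
      exact Finset.le_sup (f := FreeMonoid.length) hv
    · intro h
      simp [Finsupp.notMem_support_iff.mp h]
  rw [hval, Submodule.mem_span_singleton] at hmem
  obtain ⟨r, hr⟩ := hmem
  have hne : Fin.ofNat n 0 ≠ Fin.ofNat n (d / 2 + 1) := by
    intro he
    have := congr_arg Fin.val he
    simp only [Fin.val_ofNat] at this
    rw [Nat.zero_mod, Nat.mod_eq_of_lt (by omega)] at this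
    omega
  have := congr_fun₂ hr (Fin.ofNat n 0) (Fin.ofNat n (d / 2 + 1))
  rw [Matrix.smul_apply, Matrix.smul_apply, Matrix.one_apply_ne hne, Matrix.single_apply_same] at this
  simp [hw] at this

end NCPoly

/-! ### Block sums and the conclusion. -/

namespace NCPoly

variable {K : Type*} [Field K] {m : ℕ}

/-- `f` takes values on `n × n` matrices with distinct eigenvalues outside any given finite set. -/
def HasSeparatedValues (f : FreeAlgebra K (Fin m)) (n : ℕ) : Prop :=
  ∀ s : Finset K, ∃ X : Fin m → Matrix (Fin n) (Fin n) K,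
    (FreeAlgebra.lift K X f).charpoly.Separable ∧
      ∀ z ∈ s, ¬ (FreeAlgebra.lift K X f).charpoly.IsRoot z

theorem lift_reindex {n n' : Type*} [Fintype n] [Fintype n'] [DecidableEq n] [DecidableEq n']
    (e : n ≃ n') (f : FreeAlgebra K (Fin m)) (X : Fin m → Matrix n n K) :
    FreeAlgebra.lift K (fun k => Matrix.reindex e e (X k)) f =
      Matrix.reindex e e (FreeAlgebra.lift K X f) := by
  have : FreeAlgebra.lift K (fun k => Matrix.reindex e e (X k)) =
      (Matrix.reindexAlgEquiv K K e).toAlgHom.comp (FreeAlgebra.lift K X) := by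
    ext k : 2
    simp
  rw [this]
  rfl

theorem lift_fromBlocks {n n' : Type*} [Fintype n] [Fintype n'] [DecidableEq n] [DecidableEq n']
    (f : FreeAlgebra K (Fin m)) (X : Fin m → Matrix n n K) (Y : Fin m → Matrix n' n' K) :
    FreeAlgebra.lift K (fun k => Matrix.fromBlocks (X k) 0 0 (Y k)) f =
      Matrix.fromBlocks (FreeAlgebra.lift K X f) 0 0 (FreeAlgebra.lift K Y f) := by
  induction f with
  | grade0 r =>
    rw [AlgHom.commutes, AlgHom.commutes, AlgHom.commutes]
    simp only [Algebra.algebraMap_eq_smul_one]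
    rw [← Matrix.fromBlocks_one, Matrix.fromBlocks_smul, smul_zero, smul_zero]
  | grade1 k => simp
  | add a b ha hb => simp only [map_add, ha, hb, Matrix.fromBlocks_add, add_zero]
  | mul a b ha hb => simp [map_mul, ha, hb, Matrix.fromBlocks_multiply]

theorem hasSeparatedValues_zero (f : FreeAlgebra K (Fin m)) : HasSeparatedValues f 0 := by
  intro s
  refine ⟨fun _ => 0, ?_⟩
  rw [Matrix.charpoly, Matrix.det_isEmpty]
  exact ⟨Polynomial.separable_one, fun z _ => by simp⟩

theorem HasSeparatedValues.add [IsAlgClosed K] {f : FreeAlgebra K (Fin m)} {a b : ℕ}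
    (ha : HasSeparatedValues f a) (hb : HasSeparatedValues f b) : HasSeparatedValues f (a + b) := by
  classical
  intro s
  obtain ⟨X, hX, hXs⟩ := ha s
  -- `Y` must also avoid the spectrum of `f(X)`, which makes the two characteristic polynomials
  -- coprime.
  obtain ⟨Y, hY, hYs⟩ := hb (s ∪ (FreeAlgebra.lift K X f).charpoly.roots.toFinset)
  refine ⟨fun k => Matrix.reindex finSumFinEquiv finSumFinEquiv
    (Matrix.fromBlocks (X k) 0 0 (Y k)), ?_⟩
  rw [lift_reindex, Matrix.charpoly_reindex, lift_fromBlocks, Matrix.charpoly_fromBlocks_zero₁₂]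
  refine ⟨hX.mul hY ?_, fun z hz => ?_⟩
  · rw [Polynomial.isCoprime_iff_aeval_ne_zero_of_isAlgClosed K K]
    intro z
    by_contra! H
    refine hYs z (Finset.mem_union_right _ ?_) (by simpa using H.2)
    simpa [Matrix.charpoly_monic, Polynomial.Monic.ne_zero] using H.1
  · rw [Polynomial.root_mul, not_or]
    exact ⟨hXs z hz, hYs z (Finset.mem_union_left _ hz)⟩

theorem HasSeparatedValues.mul_left [IsAlgClosed K] {f : FreeAlgebra K (Fin m)} {a : ℕ}
    (ha : HasSeparatedValues f a) (k : ℕ) : HasSeparatedValues f (k * a) := by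
  induction k with
  | zero => simpa using hasSeparatedValues_zero f
  | succ k ih => rw [Nat.succ_mul]; exact ih.add ha

theorem hasSeparatedValues_prime [IsAlgClosed K] [CharZero K] {f : FreeAlgebra K (Fin m)}
    (hf : Nonconstant f) {p : ℕ} (hp : p.Prime) (hdeg : deg f + 2 ≤ 2 * p) :
    HasSeparatedValues f p := by
  intro s
  have : NeZero p := ⟨hp.ne_zero⟩
  obtain ⟨X, hX⟩ := exists_eval_nonscalar hf hdeg
  let e : Fin p ≃ ZMod p := (ZMod.finEquiv p).toEquiv
  obtain ⟨Y, hY, hYs⟩ := exists_charpoly_separable_of_nonscalar hp f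
    (fun k => Matrix.reindex e e (X k)) (by
      rw [lift_reindex]
      intro h
      obtain ⟨r, hr⟩ := Submodule.mem_span_singleton.mp h
      refine hX (Submodule.mem_span_singleton.mpr ⟨r, (Matrix.reindex e e).injective ?_⟩)
      rw [← hr, Matrix.reindex_apply, Matrix.submatrix_smul, Pi.smul_apply, Pi.smul_apply,
        Matrix.submatrix_one_equiv]) s
  refine ⟨fun k => Matrix.reindex e.symm e.symm (Y k), ?_⟩
  rw [lift_reindex, Matrix.charpoly_reindex]
  exact ⟨hY, hYs⟩

theorem distinctNonzeroLocus_nonempty [IsAlgClosed K] {f : FreeAlgebra K (Fin m)} {n : ℕ}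
    (h : HasSeparatedValues f n) : (distinctNonzeroLocus f n).Nonempty := by
  obtain ⟨X, hX, hX0⟩ := h {0}
  exact ⟨X, (mem_distinctNonzeroLocus_iff f X).mpr ⟨hX, hX0 0 (Finset.mem_singleton_self 0)⟩⟩

end NCPoly

theorem corollary2p8 {K : Type*} [Field K] [IsAlgClosed K] [CharZero K] (m : ℕ)
    (f : FreeAlgebra K (Fin m)) (hf : NCPoly.Nonconstant f) :
    (∃ N : ℕ, ∀ n : ℕ, N ≤ n →
      NCPoly.IsZariskiOpen (NCPoly.distinctNonzeroLocus f n) ∧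
        (NCPoly.distinctNonzeroLocus f n).Nonempty) ∧
    (∀ p q : ℕ, p.Prime → q.Prime → p < q → ⌈(NCPoly.deg f : ℚ) / 2⌉₊ < p →
      ∀ n : ℕ, (p - 1) * (q - 1) ≤ n →
        NCPoly.IsZariskiOpen (NCPoly.distinctNonzeroLocus f n) ∧
          (NCPoly.distinctNonzeroLocus f n).Nonempty) := by
  have key : ∀ p q : ℕ, p.Prime → q.Prime → p < q → ⌈(NCPoly.deg f : ℚ) / 2⌉₊ < p →
      ∀ n : ℕ, (p - 1) * (q - 1) ≤ n →
        NCPoly.IsZariskiOpen (NCPoly.distinctNonzeroLocus f n) ∧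
          (NCPoly.distinctNonzeroLocus f n).Nonempty := by
    intro p q hp hq hpq hdeg n hn
    have hdp : NCPoly.deg f + 2 ≤ 2 * p := by
      have h1 : (NCPoly.deg f : ℚ) / 2 ≤ ((p - 1 : ℕ) : ℚ) :=
        Nat.ceil_le.mp (Nat.le_sub_one_of_lt hdeg)
      rw [div_le_iff₀ two_pos] at h1
      have h2 : NCPoly.deg f ≤ (p - 1) * 2 := by exact_mod_cast h1
      have := hp.one_lt
      omega
    have hcop : p.gcd q = 1 := (Nat.coprime_primes hp hq).mpr hpq.ne
    -- The two-coin Frobenius bound for coprime `p` and `q`.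
    obtain ⟨a, b, rfl⟩ := Nat.exists_add_mul_eq_of_gcd_dvd_of_mul_pred_le p q n
      (by rw [hcop]; exact one_dvd n) hn
    refine ⟨NCPoly.isZariskiOpen_distinctNonzeroLocus f _, NCPoly.distinctNonzeroLocus_nonempty ?_⟩
    exact ((NCPoly.hasSeparatedValues_prime hf hp hdp).mul_left a).add
      ((NCPoly.hasSeparatedValues_prime hf hq (by omega)).mul_left b)
  refine ⟨?_, key⟩
  obtain ⟨p, hp, hpp⟩ := Nat.exists_infinite_primes (⌈(NCPoly.deg f : ℚ) / 2⌉₊ + 1)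
  obtain ⟨q, hq, hqp⟩ := Nat.exists_infinite_primes (p + 1)
  exact ⟨(p - 1) * (q - 1), key p q hpp hqp hq hp⟩
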